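/- Fix a number of classes $C\in\mathbb N$, a constant $k_0\in\mathbb N=\{0,1,2,\dots\}$, $\sigma>0$, $P_{\mathsf{con}}<1$ and $c>0$. For $d\in\mathbb N$ let $\mathcal N(\sigma)=\mathcal N(0,\sigma^2 I_d)$ on $\mathbb R^d$, and for $d>2k_0$ let $\mathcal N^{g}(k_0,\sigma)$ be the probability distribution on $\mathbb R^d$ with Lebesgue density proportional to $$\|\varepsilon\|_2^{-2k_0}\exp\!\Big(-\frac{\|\varepsilon\|_2^2}{2\sigma'^2}\Big),\qquad \sigma'=\sqrt{\tfrac{d}{d-2k_0}}\;\sigma ,$$ so that $\mathcal N^{g}(0,\sigma)=\mathcal N(\sigma)$ is the standard Gaussian smoothing distribution. For a (measurable) base classifier $F:\mathbb R^d\to\{1,\dots,C\}$ and a distribution $\mathcal P$ on $\mathbb R^d$, a smoothed classifier $\widetilde F^{\mathcal P}$ is a map with $\widetilde F^{\mathcal P}(x)\in\arg\max_{y}\Pr_{\varepsilon\sim\mathcal P}[F(x+\varepsilon)=y]$ for all $x$ (ties broken arbitrarily). A number $r\ge 0$ is a certified $\ell_2$ radius for $\widetilde F^{\mathcal P}$ at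 $x_0$ with label $y_0$ if $\widetilde F^{\mathcal P}(x_0+\delta)=y_0$ for all $\delta$ with $\|\delta\|_2<r$. A certification method is any rule that assigns to every base classifier $F$, smoothed classifier $\widetilde F^{\mathcal P}$ of $F$, input and label a radius that is always a certified radius. The classifier $F$ has the $(\sigma,P_{\mathsf{con}})$-concentration property at $x_0$ with true label $y_0$ if $$\Pr_{\varepsilon\sim\mathcal N(\sigma)}\big[F(x_0+\varepsilon)=y_0\;\big|\;\|\varepsilon\|_2\le T\big]=1\quad\text{for a } T \text{ with}\quad \Pr_{\varepsilon\sim\mathcal N(\sigma)}[\|\varepsilon\|_2\le T]=P_{\mathsf{con}}$$ (in particular $P_{\mathsf{con}}>0$, so that the conditional probability makes sense). Theorem. There is $d_0$ (depending only on $C,k_0,\sigma,P_{\mathsf{con}},c$) such that for every $d\ge d_0$, every $x_0\in\mathbb R^d$, every label $y_0$ and every base classifier $F_0:\mathbb R^d\to\{1,\dots,C\}$ that has the $(\sigma,P_{\mathsf{con}})$-concentration property at $x_0$ with true label $y_0$ and satisfies $\Pr_{\varepsilon\sim\mathcal N(\sigma)}[F_0(x_0+\varepsilon)=y_0]=P_{\mathsf{con}}$,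 the following holds for every smoothed classifier $\widetilde F_0=\widetilde F_0^{\mathcal P'}$ with $\mathcal P'=\mathcal N^{g}(k_0,\sigma)$: 1. the smoothed classifier is fooled within radius $c\sqrt d$: there is $\delta\in\mathbb R^d$ with $\|\delta\|_2<c\sqrt d$ and $\widetilde F_0(x_0+\delta)\ne y_0$; 2. consequently no certification method can certify the $\ell_2$ radius $c\sqrt d$: every certification method for classifiers smoothed by $\mathcal P'$ returns a radius smaller than $c\sqrt d$ for $F_0,\widetilde F_0,x_0,y_0$. -/

import Mathlib

open MeasureTheory ProbabilityTheory
open scoped ENNReal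

/-- `ℝᵈ` with the `ℓ₂` norm. -/
abbrev InputSpace (d : ℕ) : Type := EuclideanSpace ℝ (Fin d)

/-- The isotropic Gaussian `𝒩(σ) = 𝒩(0, σ² I_d)` on `ℝᵈ`. -/
noncomputable def isoGaussian (d : ℕ) (σ : ℝ) : Measure (InputSpace d) :=
  multivariateGaussian 0 (σ ^ 2 • (1 : Matrix (Fin d) (Fin d) ℝ))

/-- The scale `σ' = √(d / (d - 2k)) σ` of the generalized Gaussian (used for `2k < d`). -/
noncomputable def genGaussianScale (d k : ℕ) (σ : ℝ) : ℝ :=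
  Real.sqrt ((d : ℝ) / ((d : ℝ) - 2 * (k : ℝ))) * σ

/-- The unnormalized density `‖ε‖^(-2k) exp(-‖ε‖² / (2σ'²))`. -/
noncomputable def genGaussianWeight (d k : ℕ) (σ : ℝ) (ε : InputSpace d) : ℝ :=
  (‖ε‖ ^ (2 * k))⁻¹ * Real.exp (-‖ε‖ ^ 2 / (2 * genGaussianScale d k σ ^ 2))

/-- The generalized Gaussian `𝒩ᵍ(k, σ)` on `ℝᵈ` (for `2k < d`, `σ > 0`): the probability measure
whose Lebesgue density is proportional to `‖ε‖^(-2k) exp(-‖ε‖² / (2σ'²))`. -/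
noncomputable def genGaussian (d k : ℕ) (σ : ℝ) : Measure (InputSpace d) :=
  (∫⁻ ε, ENNReal.ofReal (genGaussianWeight d k σ ε))⁻¹ •
    volume.withDensity fun ε => ENNReal.ofReal (genGaussianWeight d k σ ε)

/-- For `k = 0` the generalized Gaussian is the standard (isotropic) Gaussian. -/
theorem genGaussian_zero (d : ℕ) (hd : 0 < d) (σ : ℝ) (hσ : 0 < σ) :
    genGaussian d 0 σ = isoGaussian d σ := by
  set b : ℝ := 1 / (2 * σ ^ 2) with hb
  have hbpos : 0 < b := by positivity
  have hd' : (d : ℝ) ≠ 0 := by positivity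
  have hw : ∀ ε : InputSpace d, genGaussianWeight d 0 σ ε = Real.exp (-b * ‖ε‖ ^ 2) := by
    intro ε
    have : genGaussianScale d 0 σ = σ := by simp [genGaussianScale, hd']
    rw [genGaussianWeight, this, hb]
    simp only [mul_zero, pow_zero, inv_one, one_mul]
    congr 1
    ring
  set Z : ℝ := ∫ ε : InputSpace d, Real.exp (-b * ‖ε‖ ^ 2) with hZ
  have hZval : Z = (Real.pi / b) ^ (d / 2 : ℝ) := by
    rw [hZ, GaussianFourier.integral_rexp_neg_mul_sq_norm hbpos]; simp
  have hZpos : 0 < Z := by rw [hZval]; positivity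
  have hint : Integrable (fun ε : InputSpace d => Real.exp (-b * ‖ε‖ ^ 2)) := by
    by_contra h
    exact hZpos.ne' (by rw [hZ, integral_undef h])
  have hlint : ∫⁻ ε : InputSpace d, ENNReal.ofReal (Real.exp (-b * ‖ε‖ ^ 2)) =
      ENNReal.ofReal Z := by
    rw [hZ, ofReal_integral_eq_lintegral_ofReal hint]
    exact Filter.Eventually.of_forall fun _ => (Real.exp_pos _).le
  have hS : ((σ ^ 2 • (1 : Matrix (Fin d) (Fin d) ℝ))).PosSemidef :=
    Matrix.PosSemidef.one.smul (sq_nonneg σ)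
  have hgen : genGaussian d 0 σ = (ENNReal.ofReal Z)⁻¹ •
      volume.withDensity fun ε : InputSpace d => ENNReal.ofReal (Real.exp (-b * ‖ε‖ ^ 2)) := by
    simp only [genGaussian, hw, hlint]
  have hfin : IsFiniteMeasure (genGaussian d 0 σ) := by
    rw [hgen]
    constructor
    rw [Measure.smul_apply, withDensity_apply _ MeasurableSet.univ, setLIntegral_univ, hlint]
    exact ENNReal.mul_lt_top (by simp [hZpos]) (by simp)
  have hfin' : IsFiniteMeasure (isoGaussian d σ) := by
    unfold isoGaussian; infer_instance
  refine Measure.ext_of_charFun (funext fun t => ?_)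
  rw [isoGaussian, charFun_multivariateGaussian hS, hgen, charFun_apply, integral_smul_measure,
    integral_withDensity_eq_integral_toReal_smul₀ (by fun_prop) (by simp)]
  have hZ' : (Z : ℂ) = (Real.pi / b) ^ (d / 2 : ℂ) := by
    have := GaussianFourier.integral_cexp_neg_mul_sq_norm (V := InputSpace d)
      (b := (b : ℂ)) (by simpa using hbpos)
    simp only [finrank_euclideanSpace, Fintype.card_fin] at this
    rw [← this, hZ, ← integral_complex_ofReal]
    congr 1; ext ε; push_cast; rfl
  have hkey := GaussianFourier.integral_cexp_neg_mul_sq_norm_add (V := InputSpace d)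
      (b := (b : ℂ)) (by simpa using hbpos) Complex.I t
  simp only [finrank_euclideanSpace, Fintype.card_fin] at hkey
  have hI : ∫ ε : InputSpace d, (ENNReal.ofReal (Real.exp (-b * ‖ε‖ ^ 2))).toReal •
      Complex.exp (inner ℝ ε t * Complex.I) =
      Z * Complex.exp (Complex.I ^ 2 * ‖t‖ ^ 2 / (4 * b)) := by
    rw [hZ', ← hkey]
    congr 1; ext ε
    rw [ENNReal.toReal_ofReal (Real.exp_pos _).le, Complex.real_smul, Complex.ofReal_exp,
      ← Complex.exp_add, real_inner_comm]
    push_cast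
    congr 1; ring
  rw [hI, ENNReal.toReal_inv, ENNReal.toReal_ofReal hZpos.le, Complex.real_smul, ← mul_assoc,
    Complex.ofReal_inv, inv_mul_cancel₀ (by exact_mod_cast hZpos.ne'), one_mul]
  congr 1
  have ht : t.ofLp ⬝ᵥ (σ ^ 2 • (1 : Matrix (Fin d) (Fin d) ℝ)).mulVec t.ofLp =
      σ ^ 2 * ‖t‖ ^ 2 := by
    rw [Matrix.smul_mulVec, Matrix.one_mulVec, dotProduct_smul, smul_eq_mul,
      EuclideanSpace.real_norm_sq_eq]
    simp [dotProduct, sq]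
  have hσ' : (σ : ℂ) ≠ 0 := by exact_mod_cast hσ.ne'
  rw [ht, hb, inner_zero_right]
  push_cast
  rw [Complex.I_sq]
  field_simp
  ring

/-- `f^P(x)_c = Pr_{ε ∼ P} [F(x + ε) = c]`. -/
noncomputable def classProb {d C : ℕ} (P : Measure (InputSpace d)) (F : InputSpace d → Fin C)
    (x : InputSpace d) (c : Fin C) : ℝ :=
  P.real {ε | F (x + ε) = c}

/-- `G` is a smoothed classifier obtained from the base classifier `F` by the noise `P`:
`G x ∈ argmax_c f^P(x)_c` for all `x`, with an arbitrary rule for breaking ties. -/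
def IsSmoothedClassifier {d C : ℕ} (P : Measure (InputSpace d))
    (F G : InputSpace d → Fin C) : Prop :=
  ∀ x c, classProb P F x c ≤ classProb P F x (G x)

/-- `r` is a certified `ℓ₂` radius for the (smoothed) classifier `G` at `x₀` with label `y₀`. -/
def IsCertifiedRadius {d C : ℕ} (G : InputSpace d → Fin C) (x₀ : InputSpace d) (y₀ : Fin C)
    (r : ℝ) : Prop :=
  0 ≤ r ∧ ∀ δ : InputSpace d, ‖δ‖ < r → G (x₀ + δ) = y₀

/-- A certification method for `P`-smoothed classifiers: any rule `M` whatsoever which, given a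
base classifier `F`, a smoothed classifier `G` obtained from it, an input and a label, outputs a
radius that is always a certified radius for `G`. -/
def IsCertificationMethod {d C : ℕ} (P : Measure (InputSpace d))
    (M : (InputSpace d → Fin C) → (InputSpace d → Fin C) → InputSpace d → Fin C → ℝ) : Prop :=
  ∀ F G : InputSpace d → Fin C, Measurable F → IsSmoothedClassifier P F G →
    ∀ (x : InputSpace d) (y : Fin C), IsCertifiedRadius G x y (M F G x y)

/-- The `(σ, p)`-concentration property of `F` at `x₀` with true label `y₀`:
`Pr_{ε ∼ 𝒩(σ)} [F(x₀ + ε) = y₀ | ‖ε‖ ≤ T] = 1` where `Pr_{ε ∼ 𝒩(σ)} [‖ε‖ ≤ T] = p`. -/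
def IsConcentrated {d C : ℕ} (σ p : ℝ) (F : InputSpace d → Fin C) (x₀ : InputSpace d)
    (y₀ : Fin C) : Prop :=
  ∃ T : ℝ, (isoGaussian d σ).real {ε | ‖ε‖ ≤ T} = p ∧
    (isoGaussian d σ)[|{ε | ‖ε‖ ≤ T}].real {ε | F (x₀ + ε) = y₀} = 1

/-! The obstruction is concentration of the norm. Up to a null set, the class `y₀` lies in a ball of
radius `T` around `x₀` (`IsConcentrated.exists_ae_norm_le`). The Gaussian mass of this ball is a
fixed `p < 1`, and `‖ε‖²` has mean `dσ²` and standard deviation of order `√d`, so `T²` exceeds `dσ²`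
by at most a small multiple of `d` (`isoGaussian_norm_le_ge`).

The scale `σ'` gives the generalized Gaussian the same mean `dσ²` of `‖ε‖²`, again with deviations
of order `√d`. A shift by `δ` of length `s = c√d/2` gives `‖δ + ε‖² = s² + 2⟨δ, ε⟩ + ‖ε‖²`, where
`s²` is of order `d` and dominates both the cross term and the fluctuation. The shifted noise thus
hits the ball with probability `O(1/d)` (`exists_shift_genGaussian_norm_le`), while a winning class
among `C` has probability at least `1/C`. For large `d`, `y₀` loses at `x₀ + δ`. -/

/-! ### Radial moments of the generalized Gaussian. -/

lemma genGaussianScale_sq {d k : ℕ} (hk : 2 * k < d) (σ : ℝ) :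
    genGaussianScale d k σ ^ 2 = d / (d - 2 * k) * σ ^ 2 := by
  have hk' : (2 * k : ℝ) < d := by exact_mod_cast hk
  rw [genGaussianScale, mul_pow, Real.sq_sqrt (div_nonneg (by positivity) (by linarith))]

lemma genGaussianScale_sq_pos {d k : ℕ} (hk : 2 * k < d) {σ : ℝ} (hσ : 0 < σ) :
    0 < genGaussianScale d k σ ^ 2 := by
  have hk' : (2 * k : ℝ) < d := by exact_mod_cast hk
  have hd : (0 : ℝ) < d := lt_of_le_of_lt (by positivity) hk'
  rw [genGaussianScale_sq hk]
  exact mul_pos (div_pos hd (by linarith)) (by positivity)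

lemma genGaussianWeight_nonneg {d k : ℕ} {σ : ℝ} (ε : InputSpace d) :
    0 ≤ genGaussianWeight d k σ ε := by
  unfold genGaussianWeight; positivity

@[fun_prop]
lemma measurable_genGaussianWeight {d k : ℕ} {σ : ℝ} :
    Measurable (genGaussianWeight d k σ) := by
  unfold genGaussianWeight; fun_prop

/-- The radial part of the integrand for the moment of order `2 * m`. -/
lemma radial_moment_eq {d k : ℕ} (hk : 2 * k < d) (m : ℕ) (b : ℝ) {r : ℝ} (hr : 0 < r) :
    r ^ (d - 1) • ((r ^ (2 * k))⁻¹ * Real.exp (-r ^ 2 / (2 * b)) * r ^ (2 * m)) =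
      r ^ ((d : ℝ) - 2 * k - 1 + 2 * m) * Real.exp (-(1 / (2 * b)) * r ^ (2 : ℝ)) := by
  -- Removes the truncated subtraction in `d - 1` and turns the real exponent into the natural
  -- number `n + 2m`.
  obtain ⟨n, rfl⟩ : ∃ n, d = n + 2 * k + 1 := ⟨d - 2 * k - 1, by omega⟩
  have h1 : (((n + 2 * k + 1 : ℕ) : ℝ) - 2 * k - 1 + 2 * m) = ((n + 2 * m : ℕ) : ℝ) := by
    push_cast; ring
  have h2 : -r ^ 2 / (2 * b) = -(1 / (2 * b)) * r ^ 2 := by ring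
  rw [h1, Real.rpow_natCast, Real.rpow_two, h2, Nat.add_sub_cancel, smul_eq_mul, pow_add, pow_add]
  field_simp

lemma integrable_genGaussianWeight_mul {d k : ℕ} (hk : 2 * k < d) {σ : ℝ} (hσ : 0 < σ) (m : ℕ) :
    Integrable fun ε : InputSpace d => genGaussianWeight d k σ ε * ‖ε‖ ^ (2 * m) := by
  have hk' : (2 * k : ℝ) + 1 ≤ d := by exact_mod_cast hk
  have : Nonempty (Fin d) := ⟨⟨0, by omega⟩⟩
  have hb := genGaussianScale_sq_pos hk hσ
  refine (integrable_fun_norm_addHaar (volume : Measure (InputSpace d))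
    (f := fun r => (r ^ (2 * k))⁻¹ * Real.exp (-r ^ 2 / (2 * genGaussianScale d k σ ^ 2)) *
      r ^ (2 * m))).2 ?_
  rw [finrank_euclideanSpace, Fintype.card_fin]
  refine (integrableOn_rpow_mul_exp_neg_mul_rpow (p := 2) (s := (d : ℝ) - 2 * k - 1 + 2 * m)
    (b := 1 / (2 * genGaussianScale d k σ ^ 2)) ?_ two_pos (by positivity)).congr_fun
    (fun r hr => (radial_moment_eq hk m _ hr).symm) measurableSet_Ioi
  have : (0 : ℝ) ≤ m := by positivity
  linarith

/-- Up to a factor that does not depend on `m`, the moment of order `2 * m` of the unnormalized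
generalized Gaussian is `(2σ'²)^m Γ((d - 2k) / 2 + m)`. -/
lemma exists_integral_genGaussianWeight_mul {d k : ℕ} (hk : 2 * k < d) {σ : ℝ} (hσ : 0 < σ) :
    ∃ A : ℝ, 0 < A ∧ ∀ m : ℕ,
      ∫ ε : InputSpace d, genGaussianWeight d k σ ε * ‖ε‖ ^ (2 * m) =
        A * ((2 * genGaussianScale d k σ ^ 2) ^ m * Real.Gamma (((d : ℝ) - 2 * k) / 2 + m)) := by
  have hk' : (2 * k : ℝ) + 1 ≤ d := by exact_mod_cast hk
  have hd : 0 < d := by omega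
  have : Nonempty (Fin d) := ⟨⟨0, by omega⟩⟩
  have hb := genGaussianScale_sq_pos hk hσ
  set b := genGaussianScale d k σ ^ 2 with hbdef
  have hball : 0 < (volume : Measure (InputSpace d)).real (Metric.ball 0 1) :=
    ENNReal.toReal_pos (Metric.measure_ball_pos _ _ one_pos).ne' measure_ball_lt_top.ne
  refine ⟨d * (volume : Measure (InputSpace d)).real (Metric.ball 0 1) *
    ((2 * b) ^ (((d : ℝ) - 2 * k) / 2) * (1 / 2)), by positivity, fun m => ?_⟩
  have hm : (0 : ℝ) ≤ m := by positivity
  have key := integral_fun_norm_addHaar (volume : Measure (InputSpace d))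
    (fun r => (r ^ (2 * k))⁻¹ * Real.exp (-r ^ 2 / (2 * b)) * r ^ (2 * m))
  rw [finrank_euclideanSpace, Fintype.card_fin,
    setIntegral_congr_fun measurableSet_Ioi (fun r hr => radial_moment_eq hk m b hr),
    integral_rpow_mul_exp_neg_mul_rpow two_pos (by linarith) (by positivity)] at key
  have h1 : ((d : ℝ) - 2 * k - 1 + 2 * m + 1) / 2 = ((d : ℝ) - 2 * k) / 2 + m := by ring
  have h2 : (1 / (2 * b)) ^ (-((d : ℝ) - 2 * k - 1 + 2 * m + 1) / 2) =
      (2 * b) ^ (((d : ℝ) - 2 * k) / 2) * (2 * b) ^ m := by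
    rw [neg_div, h1, one_div, Real.inv_rpow (by positivity), Real.rpow_neg (by positivity), inv_inv,
      Real.rpow_add (by positivity), Real.rpow_natCast]
  rw [h1, h2, nsmul_eq_mul, smul_eq_mul] at key
  simp only [genGaussianWeight, ← hbdef]
  rw [key]
  ring

lemma integral_genGaussianWeight_pos {d k : ℕ} (hk : 2 * k < d) {σ : ℝ} (hσ : 0 < σ) :
    0 < ∫ ε : InputSpace d, genGaussianWeight d k σ ε := by
  have hk' : (2 * k : ℝ) < d := by exact_mod_cast hk
  obtain ⟨A, hA, h⟩ := exists_integral_genGaussianWeight_mul hk hσ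
  have h0 := h 0
  simp only [mul_zero, pow_zero, mul_one, one_mul, Nat.cast_zero, add_zero] at h0
  rw [h0]
  exact mul_pos hA (Real.Gamma_pos_of_pos (by linarith))

lemma genGaussian_eq {d k : ℕ} (hk : 2 * k < d) {σ : ℝ} (hσ : 0 < σ) :
    genGaussian d k σ = (ENNReal.ofReal (∫ ε : InputSpace d, genGaussianWeight d k σ ε))⁻¹ •
      volume.withDensity fun ε => ENNReal.ofReal (genGaussianWeight d k σ ε) := by
  rw [genGaussian, ofReal_integral_eq_lintegral_ofReal
    (by simpa using integrable_genGaussianWeight_mul hk hσ 0)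
    (Filter.Eventually.of_forall genGaussianWeight_nonneg)]

lemma genGaussian_absolutelyContinuous (d k : ℕ) (σ : ℝ) : genGaussian d k σ ≪ volume :=
  (withDensity_absolutelyContinuous _ _).smul_left _

/-- The density is positive everywhere. This carries Gaussian null sets to Lebesgue null sets, which
survive translation. -/
lemma volume_absolutelyContinuous_isoGaussian {d : ℕ} (hd : 0 < d) {σ : ℝ} (hσ : 0 < σ) :
    volume ≪ isoGaussian d σ := by
  rw [← genGaussian_zero d hd σ hσ, genGaussian_eq (by omega) hσ]
  refine (withDensity_absolutelyContinuous' (by fun_prop) (ae_of_all _ fun ε => ?_)).trans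
    (Measure.absolutelyContinuous_smul (by simp))
  simp [genGaussianWeight, Real.exp_pos]

lemma isProbabilityMeasure_genGaussian {d k : ℕ} (hk : 2 * k < d) {σ : ℝ} (hσ : 0 < σ) :
    IsProbabilityMeasure (genGaussian d k σ) := by
  have hpos := integral_genGaussianWeight_pos hk hσ
  constructor
  rw [genGaussian_eq hk hσ, Measure.smul_apply, withDensity_apply _ MeasurableSet.univ,
    setLIntegral_univ, ← ofReal_integral_eq_lintegral_ofReal
    (by simpa using integrable_genGaussianWeight_mul hk hσ 0)
    (Filter.Eventually.of_forall genGaussianWeight_nonneg), smul_eq_mul]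
  exact ENNReal.inv_mul_cancel (by simpa using hpos) (by simp)

lemma integrable_genGaussian {d k : ℕ} (hk : 2 * k < d) {σ : ℝ} (hσ : 0 < σ) (m : ℕ) :
    Integrable (fun ε => ‖ε‖ ^ (2 * m)) (genGaussian d k σ) := by
  have hpos := integral_genGaussianWeight_pos hk hσ
  rw [genGaussian_eq hk hσ]
  refine Integrable.smul_measure ?_ (by simpa using hpos)
  rw [integrable_withDensity_iff_integrable_smul' (by fun_prop) (by simp)]
  simpa [ENNReal.toReal_ofReal (genGaussianWeight_nonneg _)] using
    integrable_genGaussianWeight_mul hk hσ m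

lemma integral_genGaussian {d k : ℕ} (hk : 2 * k < d) {σ : ℝ} (hσ : 0 < σ) (m : ℕ) :
    ∫ ε, ‖ε‖ ^ (2 * m) ∂genGaussian d k σ =
      (2 * genGaussianScale d k σ ^ 2) ^ m *
        (Real.Gamma (((d : ℝ) - 2 * k) / 2 + m) / Real.Gamma (((d : ℝ) - 2 * k) / 2)) := by
  have hk' : (2 * k : ℝ) < d := by exact_mod_cast hk
  have hpos := integral_genGaussianWeight_pos hk hσ
  obtain ⟨A, hA, h⟩ := exists_integral_genGaussianWeight_mul hk hσ
  have h0 := h 0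
  have hG : 0 < Real.Gamma (((d : ℝ) - 2 * k) / 2) := Real.Gamma_pos_of_pos (by linarith)
  simp only [mul_zero, pow_zero, mul_one, one_mul, Nat.cast_zero, add_zero] at h0
  rw [genGaussian_eq hk hσ, integral_smul_measure,
    integral_withDensity_eq_integral_toReal_smul₀ (by fun_prop) (by simp)]
  simp only [ENNReal.toReal_ofReal (genGaussianWeight_nonneg _), smul_eq_mul]
  rw [h, ENNReal.toReal_inv, ENNReal.toReal_ofReal hpos.le, h0]
  field_simp

/-- The factor `d / (d - 2k)` in `σ'²` cancels the Gamma ratio `(d - 2k) / 2`, so the mean does not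
depend on `k`. -/
lemma integral_norm_sq_genGaussian {d k : ℕ} (hk : 2 * k < d) {σ : ℝ} (hσ : 0 < σ) :
    ∫ ε, ‖ε‖ ^ 2 ∂genGaussian d k σ = d * σ ^ 2 := by
  have hk' : (0 : ℝ) < d - 2 * k := sub_pos.2 (by exact_mod_cast hk)
  have hG : Real.Gamma (((d : ℝ) - 2 * k) / 2) ≠ 0 := (Real.Gamma_pos_of_pos (by linarith)).ne'
  have h := integral_genGaussian hk hσ 1
  rw [genGaussianScale_sq hk, Nat.cast_one, Real.Gamma_add_one (by positivity)] at h
  rw [show (fun ε : InputSpace d => ‖ε‖ ^ 2) = fun ε => ‖ε‖ ^ (2 * 1) from rfl, h]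
  field_simp

lemma integral_norm_pow_four_genGaussian {d k : ℕ} (hk : 2 * k < d) {σ : ℝ} (hσ : 0 < σ) :
    ∫ ε, ‖ε‖ ^ 4 ∂genGaussian d k σ = (d * σ ^ 2) ^ 2 * (1 + 2 / (d - 2 * k)) := by
  have hk' : (0 : ℝ) < d - 2 * k := sub_pos.2 (by exact_mod_cast hk)
  have hG : Real.Gamma (((d : ℝ) - 2 * k) / 2) ≠ 0 := (Real.Gamma_pos_of_pos (by linarith)).ne'
  have h := integral_genGaussian hk hσ 2
  rw [genGaussianScale_sq hk, Nat.cast_two,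
    show ((d : ℝ) - 2 * k) / 2 + 2 = ((d : ℝ) - 2 * k) / 2 + 1 + 1 by ring,
    Real.Gamma_add_one (by positivity), Real.Gamma_add_one (by positivity)] at h
  rw [show (fun ε : InputSpace d => ‖ε‖ ^ 4) = fun ε => ‖ε‖ ^ (2 * 2) from rfl]
  refine h.trans ?_
  field_simp

lemma integrable_norm_sq_sub_sq_genGaussian {d k : ℕ} (hk : 2 * k < d) {σ : ℝ} (hσ : 0 < σ)
    (a : ℝ) : Integrable (fun ε => (‖ε‖ ^ 2 - a) ^ 2) (genGaussian d k σ) := by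
  have := isProbabilityMeasure_genGaussian hk hσ
  have h : (fun ε : InputSpace d => (‖ε‖ ^ 2 - a) ^ 2) =
      fun ε => ‖ε‖ ^ (2 * 2) - 2 * a * ‖ε‖ ^ (2 * 1) + a ^ 2 := by ext ε; ring
  rw [h]
  exact ((integrable_genGaussian hk hσ 2).sub ((integrable_genGaussian hk hσ 1).const_mul _)).add
    (integrable_const _)

/-- The variance of the squared norm. -/
lemma integral_norm_sq_sub_sq_genGaussian {d k : ℕ} (hk : 2 * k < d) {σ : ℝ} (hσ : 0 < σ) :
    ∫ ε, (‖ε‖ ^ 2 - d * σ ^ 2) ^ 2 ∂genGaussian d k σ =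
      2 * (d * σ ^ 2) ^ 2 / (d - 2 * k) := by
  have := isProbabilityMeasure_genGaussian hk hσ
  have h : (fun ε : InputSpace d => (‖ε‖ ^ 2 - d * σ ^ 2) ^ 2) =
      fun ε => ‖ε‖ ^ 4 - 2 * (d * σ ^ 2) * ‖ε‖ ^ 2 + (d * σ ^ 2) ^ 2 := by ext ε; ring
  have h4 : Integrable (fun ε => ‖ε‖ ^ 4) (genGaussian d k σ) := integrable_genGaussian hk hσ 2
  have h2 : Integrable (fun ε => 2 * (d * σ ^ 2) * ‖ε‖ ^ 2) (genGaussian d k σ) :=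
    (integrable_genGaussian hk hσ 1).const_mul _
  have h42 : Integrable (fun ε => ‖ε‖ ^ 4 - 2 * (d * σ ^ 2) * ‖ε‖ ^ 2) (genGaussian d k σ) :=
    h4.sub h2
  rw [h, integral_add h42 (integrable_const _), integral_sub h4 h2, integral_const_mul,
    integral_norm_sq_genGaussian hk hσ, integral_norm_pow_four_genGaussian hk hσ]
  simp only [integral_const, probReal_univ, one_smul]
  ring

lemma integrable_coord_sq_genGaussian {d k : ℕ} (hk : 2 * k < d) {σ : ℝ} (hσ : 0 < σ)
    (i : Fin d) : Integrable (fun ε : InputSpace d => ε i ^ 2) (genGaussian d k σ) := by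
  refine (integrable_genGaussian hk hσ 1).mono' (by fun_prop) (ae_of_all _ fun ε => ?_)
  rw [Real.norm_eq_abs, abs_of_nonneg (sq_nonneg _), mul_one, ← sq_abs, ← Real.norm_eq_abs]
  exact pow_le_pow_left₀ (norm_nonneg _) (PiLp.norm_apply_le ε i) 2

/-- The coordinate second moments sum to `dσ²`, so one is at most the average; rotation invariance
is not needed. -/
lemma exists_integral_coord_sq_genGaussian_le {d k : ℕ} (hk : 2 * k < d) {σ : ℝ} (hσ : 0 < σ) :
    ∃ i : Fin d, ∫ ε : InputSpace d, ε i ^ 2 ∂genGaussian d k σ ≤ σ ^ 2 := by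
  have : Nonempty (Fin d) := ⟨⟨0, by omega⟩⟩
  have hsum : ∑ i : Fin d, ∫ ε : InputSpace d, ε i ^ 2 ∂genGaussian d k σ =
      ∑ _i : Fin d, σ ^ 2 := by
    rw [← integral_finsetSum _ fun i _ => integrable_coord_sq_genGaussian hk hσ i]
    simp only [← EuclideanSpace.real_norm_sq_eq]
    simp [integral_norm_sq_genGaussian hk hσ]
  obtain ⟨i, -, hi⟩ := Finset.exists_le_of_sum_le Finset.univ_nonempty hsum.le
  exact ⟨i, hi⟩

/-! ### Tail bounds for the norm, unshifted and shifted. -/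

/-- Chebyshev's inequality for the squared norm under the isotropic Gaussian. -/
lemma isoGaussian_norm_le_ge {d : ℕ} (hd : 0 < d) {σ : ℝ} (hσ : 0 < σ) {t T : ℝ} (ht : 0 < t)
    (hT0 : 0 ≤ T) (hT : d * σ ^ 2 + t ≤ T ^ 2) :
    1 - 2 * d * σ ^ 4 / t ^ 2 ≤ (isoGaussian d σ).real {ε | ‖ε‖ ≤ T} := by
  have hk : 2 * 0 < d := by omega
  have hd' : (d : ℝ) ≠ 0 := by positivity
  rw [← genGaussian_zero d hd σ hσ]
  have := isProbabilityMeasure_genGaussian hk hσ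
  have hmk := mul_meas_ge_le_integral_of_nonneg (μ := genGaussian d 0 σ)
    (ae_of_all _ fun ε => sq_nonneg (‖ε‖ ^ 2 - d * σ ^ 2))
    (integrable_norm_sq_sub_sq_genGaussian hk hσ _) (t ^ 2)
  rw [integral_norm_sq_sub_sq_genGaussian hk hσ, mul_comm, ← le_div_iff₀ (by positivity)] at hmk
  have hms : MeasurableSet {ε : InputSpace d | ‖ε‖ ≤ T} :=
    measurableSet_le measurable_norm measurable_const
  have hsub : {ε : InputSpace d | ‖ε‖ ≤ T}ᶜ ⊆ {ε | t ^ 2 ≤ (‖ε‖ ^ 2 - d * σ ^ 2) ^ 2} := by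
    intro ε hε
    simp only [Set.mem_compl_iff, Set.mem_ofPred_eq, not_le] at hε ⊢
    have : T ^ 2 ≤ ‖ε‖ ^ 2 := pow_le_pow_left₀ hT0 hε.le 2
    exact pow_le_pow_left₀ ht.le (by linarith) 2
  have hc := measureReal_mono (μ := genGaussian d 0 σ) hsub
  rw [probReal_compl_eq_one_sub hms] at hc
  have he : 2 * (d * σ ^ 2) ^ 2 / (d - 2 * ((0 : ℕ) : ℝ)) / t ^ 2 = 2 * d * σ ^ 4 / t ^ 2 := by
    rw [Nat.cast_zero, mul_zero, sub_zero]
    field_simp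
  linarith

/-- Splits a deviation into a norm part `u` and a cross term `v`, so that Markov's inequality needs
only their second moments and no independence. -/
lemma sq_le_two_mul_sq_add {a u v : ℝ} (ha : 0 ≤ a) (h : a ≤ -(u + 2 * v)) :
    a ^ 2 ≤ 2 * u ^ 2 + 8 * v ^ 2 := by
  have h4 := pow_le_pow_left₀ ha h 2
  linarith [sq_nonneg (u - 2 * v)]

/-- Along a suitable coordinate axis, a shift of length `s` moves almost all of the mass of the
generalized Gaussian out of the ball of radius `T`. -/
lemma exists_shift_genGaussian_norm_le {d k : ℕ} (hd : 0 < d) (hk : 4 * k ≤ d) {σ : ℝ}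
    (hσ : 0 < σ) {s T : ℝ} (hs : 0 < s) (hT : T ^ 2 ≤ d * σ ^ 2 + s ^ 2 / 2) :
    ∃ δ : InputSpace d, ‖δ‖ = s ∧ (genGaussian d k σ).real {ε | ‖δ + ε‖ ≤ T} ≤
      (8 * d * σ ^ 4 + 8 * s ^ 2 * σ ^ 2) / (s ^ 2 / 2) ^ 2 := by
  have hk2 : 2 * k < d := by omega
  have hk' : (4 * k : ℝ) ≤ d := by exact_mod_cast hk
  have hd' : (0 : ℝ) < d := by exact_mod_cast hd
  have := isProbabilityMeasure_genGaussian hk2 hσ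
  obtain ⟨i, hi⟩ := exists_integral_coord_sq_genGaussian_le hk2 hσ
  refine ⟨EuclideanSpace.single i s, by simp [abs_of_pos hs], ?_⟩
  have i1 := (integrable_norm_sq_sub_sq_genGaussian hk2 hσ (d * σ ^ 2)).const_mul 2
  have i2 := (integrable_coord_sq_genGaussian hk2 hσ i).const_mul (8 * s ^ 2)
  have i3 : Integrable (fun ε => 2 * (‖ε‖ ^ 2 - d * σ ^ 2) ^ 2 + 8 * s ^ 2 * ε i ^ 2)
      (genGaussian d k σ) := i1.add i2
  have h0 (ε : InputSpace d) : 0 ≤ 2 * (‖ε‖ ^ 2 - d * σ ^ 2) ^ 2 + 8 * s ^ 2 * ε i ^ 2 := by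
    positivity
  have hmk := mul_meas_ge_le_integral_of_nonneg (ae_of_all _ h0) i3 ((s ^ 2 / 2) ^ 2)
  rw [integral_add i1 i2, integral_const_mul, integral_const_mul,
    integral_norm_sq_sub_sq_genGaussian hk2 hσ] at hmk
  -- Uses `d - 2k ≥ d/2`, which is `4k ≤ d`.
  have hvar : 2 * (d * σ ^ 2) ^ 2 / (d - 2 * k) ≤ 4 * d * σ ^ 4 := by
    rw [div_le_iff₀ (by linarith)]
    have : 0 ≤ d * σ ^ 4 * (2 * (d : ℝ) - 8 * k) := mul_nonneg (by positivity) (by linarith)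
    linarith
  have hcoord := mul_le_mul_of_nonneg_left hi (show 0 ≤ 8 * s ^ 2 by positivity)
  rw [le_div_iff₀' (by positivity)]
  refine le_trans (mul_le_mul_of_nonneg_left (measureReal_mono fun ε hε => ?_) (by positivity))
    (hmk.trans (by linarith))
  simp only [Set.mem_ofPred_eq] at hε ⊢
  have h1 : ‖EuclideanSpace.single i s + ε‖ ^ 2 = s ^ 2 + 2 * (s * ε i) + ‖ε‖ ^ 2 := by
    rw [norm_add_sq_real, EuclideanSpace.inner_single_left]
    simp
  have h2 := pow_le_pow_left₀ (norm_nonneg _) hε 2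
  rw [h1] at h2
  -- The shift adds `s²` but the ball has slack only `s²/2`; the fluctuations must make up the rest.
  have h3 : s ^ 2 / 2 ≤ -((‖ε‖ ^ 2 - d * σ ^ 2) + 2 * (s * ε i)) := by linarith
  refine (sq_le_two_mul_sq_add (by positivity) h3).trans_eq ?_
  ring

/-! ### Fooling the smoothed classifier. -/

/-- A concentrated classifier whose true class has no further mass: that class is the ball of
radius `T`, up to a Lebesgue null set. -/
lemma IsConcentrated.exists_ae_norm_le {d C : ℕ} (hd : 0 < d) {σ p : ℝ} (hσ : 0 < σ)
    {F : InputSpace d → Fin C} {x₀ : InputSpace d} {y₀ : Fin C}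
    (hcon : IsConcentrated σ p F x₀ y₀) (hp : (isoGaussian d σ).real {ε | F (x₀ + ε) = y₀} = p) :
    ∃ T : ℝ, 0 ≤ T ∧ (isoGaussian d σ).real {ε | ‖ε‖ ≤ T} = p ∧
      ∀ᵐ ε : InputSpace d, F (x₀ + ε) = y₀ → ‖ε‖ ≤ T := by
  obtain ⟨T, hT, hcond⟩ := hcon
  have hfin : IsProbabilityMeasure (isoGaussian d σ) := by
    unfold isoGaussian; infer_instance
  have hB : MeasurableSet {ε : InputSpace d | ‖ε‖ ≤ T} :=
    measurableSet_le measurable_norm measurable_const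
  rw [measureReal_def, cond_apply hB, ENNReal.toReal_mul, ENNReal.toReal_inv, ← measureReal_def,
    ← measureReal_def, hT] at hcond
  -- With `p = 0` the conditional probability is `0` by the convention `0⁻¹ = 0` in `ℝ`, not `1`.
  -- This later excludes an empty ball, that is, `T < 0`.
  have hp0 : p ≠ 0 := by rintro rfl; simp at hcond
  have hinter : (isoGaussian d σ).real ({ε | ‖ε‖ ≤ T} ∩ {ε | F (x₀ + ε) = y₀}) = p := by
    field_simp at hcond
    exact hcond
  refine ⟨T, ?_, hT, (volume_absolutelyContinuous_isoGaussian hd hσ).ae_le ?_⟩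
  · by_contra! h
    have : {ε : InputSpace d | ‖ε‖ ≤ T} = ∅ := by
      ext ε
      simpa using h.trans_le (norm_nonneg ε)
    rw [this] at hT
    exact hp0 (by simpa using hT.symm)
  · have hdiff := measureReal_inter_add_sdiff (μ := isoGaussian d σ)
      (s := {ε | F (x₀ + ε) = y₀}) hB
    rw [Set.inter_comm, hinter, hp] at hdiff
    have h0 : (isoGaussian d σ) ({ε | F (x₀ + ε) = y₀} \ {ε | ‖ε‖ ≤ T}) = 0 := by
      rw [← measureReal_eq_zero_iff]; linarith
    filter_upwards [measure_eq_zero_iff_ae_notMem.1 h0] with ε hε h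
    by_contra h'
    exact hε ⟨h, h'⟩

/-- Pigeonhole: the class probabilities sum to `1`, so the largest is at least `1/C`. -/
lemma IsSmoothedClassifier.one_le_mul_classProb {d C : ℕ} {P : Measure (InputSpace d)}
    [IsProbabilityMeasure P] {F G : InputSpace d → Fin C} (hF : Measurable F)
    (hG : IsSmoothedClassifier P F G) (x : InputSpace d) : 1 ≤ C * classProb P F x (G x) := by
  have hsum : ∑ c : Fin C, classProb P F x c = 1 := by
    have hm : Measurable fun ε => F (x + ε) := hF.comp (measurable_const_add x)
    have h := measureReal_biUnion_finset (μ := P) (s := Finset.univ)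
      (f := fun c : Fin C => {ε | F (x + ε) = c})
      (fun a _ b _ hab => Set.disjoint_left.2 fun ε ha hb => hab (ha.symm.trans hb))
      (fun c _ => hm (measurableSet_singleton c))
    have hu : ⋃ c ∈ (Finset.univ : Finset (Fin C)), {ε | F (x + ε) = c} = Set.univ := by
      ext ε; simp
    rw [hu, probReal_univ] at h
    exact h.symm
  calc (1 : ℝ) = ∑ c : Fin C, classProb P F x c := hsum.symm
    _ ≤ ∑ _c : Fin C, classProb P F x (G x) := Finset.sum_le_sum fun c _ => hG x c
    _ = C * classProb P F x (G x) := by simp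

lemma exists_smoothedClassifier_ne {C k : ℕ} {σ : ℝ} (hσ : 0 < σ) {p : ℝ} (hp : p < 1)
    {c : ℝ} (hc : 0 < c) :
    ∃ d₀ : ℕ, ∀ d : ℕ, d₀ ≤ d →
      ∀ (F₀ : InputSpace d → Fin C) (x₀ : InputSpace d) (y₀ : Fin C),
        Measurable F₀ → IsConcentrated σ p F₀ x₀ y₀ →
        (isoGaussian d σ).real {ε | F₀ (x₀ + ε) = y₀} = p →
        ∀ G : InputSpace d → Fin C, IsSmoothedClassifier (genGaussian d k σ) F₀ G →
          ∃ δ : InputSpace d, ‖δ‖ < c * Real.sqrt d ∧ G (x₀ + δ) ≠ y₀ := by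
  -- `K / d` is the shift bound at `s = c√d/2`; it also dominates the Chebyshev bound at `t =
  -- c²d/8`.
  set K : ℝ := (8 * σ ^ 4 + 2 * c ^ 2 * σ ^ 2) / (c ^ 2 / 8) ^ 2 with hK
  have hKpos : 0 < K := by positivity
  have hp' : 0 < 1 - p := by linarith
  -- The first bound gives `K/d < 1/C` for the pigeonhole, the second `K/d < 1 - p` for the bound on
  -- `T`.
  obtain ⟨N, hN⟩ := exists_nat_gt (max (K * C) (K / (1 - p)))
  refine ⟨N + 4 * k + 1, fun d hd F₀ x₀ y₀ hF hcon hpF G hG => ?_⟩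
  have hd0 : 0 < d := by omega
  have hd' : (0 : ℝ) < d := by exact_mod_cast hd0
  have hNd : (N : ℝ) ≤ d := by exact_mod_cast (show N ≤ d by omega)
  have hKC : K * C < d := ((le_max_left _ _).trans_lt hN).trans_le hNd
  have hKp : K / (1 - p) < d := ((le_max_right _ _).trans_lt hN).trans_le hNd
  have hprob := isProbabilityMeasure_genGaussian (show 2 * k < d by omega) hσ
  obtain ⟨T, hT0, hT, hae⟩ := hcon.exists_ae_norm_le hd0 hσ hpF
  have hs : 0 < c / 2 * Real.sqrt d := by positivity
  have hs2 : (c / 2 * Real.sqrt d) ^ 2 = c ^ 2 / 4 * d := by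
    rw [mul_pow, Real.sq_sqrt hd'.le]; ring
  -- A larger ball would have Gaussian mass at least `1 - K/d > p`.
  have hTle : T ^ 2 ≤ d * σ ^ 2 + (c / 2 * Real.sqrt d) ^ 2 / 2 := by
    by_contra! h
    rw [hs2] at h
    have h1 := isoGaussian_norm_le_ge hd0 hσ (t := c ^ 2 / 8 * d) (by positivity) hT0
      (by linarith)
    rw [hT] at h1
    have h2 : 2 * d * σ ^ 4 / (c ^ 2 / 8 * d) ^ 2 ≤ K / d := by
      rw [hK, div_div, div_le_div_iff₀ (by positivity) (by positivity)]
      have : 0 ≤ (6 * σ ^ 4 + 2 * c ^ 2 * σ ^ 2) * (c ^ 2 / 8) ^ 2 * (d : ℝ) ^ 2 := by positivity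
      linarith
    have h3 : K / d < 1 - p := by rwa [div_lt_comm₀ hd' hp']
    linarith
  obtain ⟨δ, hδ, hle⟩ := exists_shift_genGaussian_norm_le hd0 (show 4 * k ≤ d by omega) hσ hs hTle
  refine ⟨δ, by rw [hδ]; linarith, fun hGy => ?_⟩
  have h1 := hG.one_le_mul_classProb hF (x₀ + δ)
  rw [hGy] at h1
  have h2 : classProb (genGaussian d k σ) F₀ (x₀ + δ) y₀ ≤
      (genGaussian d k σ).real {ε | ‖δ + ε‖ ≤ T} := by
    refine ENNReal.toReal_mono (measure_ne_top _ _) (measure_mono_ae ?_)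
    -- The inclusion of the class in the ball holds only almost everywhere; translation preserves
    -- Lebesgue null sets, and these are null for the noise.
    have hshift := (measurePreserving_add_left (volume : Measure (InputSpace d))
      δ).quasiMeasurePreserving.ae hae
    filter_upwards [(genGaussian_absolutelyContinuous d k σ).ae_le hshift] with ε hε h
    exact hε (by rw [← add_assoc]; exact h)
  have h3 : (8 * d * σ ^ 4 + 8 * (c / 2 * Real.sqrt d) ^ 2 * σ ^ 2) /
      ((c / 2 * Real.sqrt d) ^ 2 / 2) ^ 2 = K / d := by
    rw [hs2, hK]; field_simp; ring
  rw [h3] at hle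
  have h4 : C * (K / d) < 1 := by
    rw [← mul_div_assoc, div_lt_one hd', mul_comm]; exact hKC
  have h5 := mul_le_mul_of_nonneg_left (h2.trans hle) (Nat.cast_nonneg (α := ℝ) C)
  linarith

theorem mainTheorem4 (C : ℕ) (k₀ : ℕ) (σ : ℝ) (hσ : 0 < σ) (Pcon : ℝ) (hPcon : Pcon < 1)
    (c : ℝ) (hc : 0 < c) :
    ∃ d₀ : ℕ, ∀ d : ℕ, d₀ ≤ d →
      ∀ (F₀ : InputSpace d → Fin C) (x₀ : InputSpace d) (y₀ : Fin C),
        Measurable F₀ →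
        IsConcentrated σ Pcon F₀ x₀ y₀ →
        (isoGaussian d σ).real {ε | F₀ (x₀ + ε) = y₀} = Pcon →
        ∀ G : InputSpace d → Fin C, IsSmoothedClassifier (genGaussian d k₀ σ) F₀ G →
          (∃ δ : InputSpace d, ‖δ‖ < c * Real.sqrt d ∧ G (x₀ + δ) ≠ y₀) ∧
          ∀ M : (InputSpace d → Fin C) → (InputSpace d → Fin C) →
              InputSpace d → Fin C → ℝ,
            IsCertificationMethod (genGaussian d k₀ σ) M →
              M F₀ G x₀ y₀ < c * Real.sqrt d := by
  obtain ⟨d₀, h⟩ := exists_smoothedClassifier_ne (C := C) (k := k₀) hσ hPcon hc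
  refine ⟨d₀, fun d hd F₀ x₀ y₀ hF hcon hp G hG => ?_⟩
  obtain ⟨δ, hδ, hne⟩ := h d hd F₀ x₀ y₀ hF hcon hp G hG
  refine ⟨⟨δ, hδ, hne⟩, fun M hM => ?_⟩
  by_contra! hr
  exact hne ((hM F₀ G hF hG x₀ y₀).2 δ (hδ.trans_le hr))
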